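/- Conventions. A ranked alphabet $\Sigma$ is a finite alphabet given with finite sets $\Sigma_k$ ($k\ge 0$) of symbols of rank $k$; $T_\Sigma$ is the set of trees in which nodes with $k$ children are labelled by elements of $\Sigma_k$, and $T_\Sigma(S)$ is the set of such trees in which elements of $S$ may also occur as labels of leaves. A tree language is recognizable if it is recognized by a deterministic bottom-up finite tree automaton. Put $X_k=\{x_1,\dots,x_k\}$. A top-down tree transducer with regular look-ahead is a tuple $M=(Q,\Sigma,\Delta,R,Q_d)$, where $Q$ is a finite set of states (symbols of rank 1, disjoint from $\Sigma\cup\Delta$), $\Sigma$ and $\Delta$ are ranked alphabets (of input and output symbols), $Q_d\subseteq Q$ is the set of initial states, and $R$ is a finite set of rules $(q[a[x_1\cdots x_k]]\to t,\ D)$ with $k\ge 0$, $q\in Q$, $a\in\Sigma_k$, $t\in T_\Delta(Q[X_k])$ and $D$ a map that assigns to each $x_i$ ($1\le i\le k$) a recognizable tree language $D(x_i)\subseteq T_\Sigma$. Here $Q[Y]=\{q[y]\mid q\in Q,\ y\in Y\}$, and for $k=0$ the left-hand side is $q[a]$ and $t\in T_\Delta$. A rewriting step $\Rightarrow_M$ on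 $T_\Delta(Q[T_\Sigma])$ replaces one subtree $q[a[\varphi_1\cdots\varphi_k]]$ by $t\langle x_1\leftarrow\varphi_1,\dots,x_k\leftarrow\varphi_k\rangle$, for a rule of $R$ as above such that $\varphi_i\in D(x_i)$ for all $i$. The transformation realized by $M$ is $$T(M)=\{(s,t)\in T_\Sigma\times T_\Delta\mid q[s]\Rightarrow_M^{*}t\text{ for some }q\in Q_d\}.$$ $M$ is linear if in the right-hand side of each rule every variable $x_i$ occurs at most once. $M$ is deterministic if $Q_d$ is a singleton and, for any two different rules $(s\to t_1,D_1)$, $(s\to t_2,D_2)$ in $R$ with the same left-hand side $s$, with variables $x_1,\dots,x_k$, there is an $i$ with $1\le i\le k$ and $D_1(x_i)\cap D_2(x_i)=\emptyset$. Let $T^R$, $LT^R$ and $DT^R$ be the classes of tree transformations realized by arbitrary, linear and deterministic top-down tree transducers with regular look-ahead, respectively. For classes $F$, $G$ of tree transformations, let $F\circ G$ be the class of all $M_1\circ M_2=\{(s,t)\mid (s,u)\in M_1\text{ and }(u,t)\in M_2\text{ for some }u\}$ with $M_1\in F$, $M_2\in G$, where $M_1\subseteq T_\Sigma\times T_\Delta$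 and $M_2\subseteq T_\Delta\times T_\Omega$ for ranked alphabets $\Sigma,\Delta,\Omega$ ($M_1$ is applied first). Theorem 4.81. 1. $T^R\circ LT^R\subseteq T^R$. 2. $DT^R\circ T^R\subseteq T^R$ and $DT^R\circ DT^R\subseteq DT^R$. -/

import Mathlib

universe u v w

namespace TreeTransducer

/-- A (finite) ranked alphabet, given by its sets `Sym k` of symbols of rank `k`.  Finiteness of the
total set says that every `Sym k` is finite and that only finitely many of them are nonempty.
A symbol with several ranks is listed once in each of the corresponding sets. -/
structure RankedAlphabet : Type (u + 1) where
  Sym : ℕ → Type u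
  finite_sym : Finite (Σ k, Sym k)

/-- `T_A(S)`: trees over the ranked alphabet `A` indexed by `S`, i.e. elements of `S` may occur as
additional labels of leaves. -/
inductive IndexedTree (A : RankedAlphabet.{u}) (S : Type v) : Type (max u v)
  | idx : S → IndexedTree A S
  | node : {k : ℕ} → A.Sym k → (Fin k → IndexedTree A S) → IndexedTree A S

/-- `T_A`: trees over `A`. -/
abbrev Tree (A : RankedAlphabet.{u}) : Type u := IndexedTree A Empty

namespace IndexedTree

/-- Replace every leaf `s ∈ S` by the tree `f s`. -/
def subst {A : RankedAlphabet.{u}} {S : Type v} {S' : Type w} (f : S → IndexedTree A S') :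
    IndexedTree A S → IndexedTree A S'
  | idx s => f s
  | node a ts => node a (fun i => subst f (ts i))

/-- The number of leaves `s ∈ S` of an indexed tree that satisfy `P`. -/
noncomputable def count {A : RankedAlphabet.{u}} {S : Type v} (P : S → Prop) :
    IndexedTree A S → ℕ
  | idx s => open Classical in if P s then 1 else 0
  | node _ ts => ∑ i, count P (ts i)

end IndexedTree

/-- The inclusion `T_A ⊆ T_A(S)`. -/
def Tree.incl {A : RankedAlphabet.{u}} (S : Type v) (t : Tree A) : IndexedTree A S :=
  IndexedTree.subst (fun e : Empty => e.elim) t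

/-- A (total) deterministic bottom-up finite tree automaton over `A`.  The transition function of a
symbol of rank `0` is the choice of its initial state. -/
structure BottomUpAutomaton (A : RankedAlphabet.{u}) : Type (u + 1) where
  State : Type u
  finite_state : Finite State
  trans : {k : ℕ} → A.Sym k → (Fin k → State) → State
  final : Set State

namespace BottomUpAutomaton

/-- The state reached after bottom-up processing of a tree. -/
def run {A : RankedAlphabet.{u}} (M : BottomUpAutomaton A) : Tree A → M.State
  | .idx e => e.elim
  | .node a ts => M.trans a (fun i => M.run (ts i))

/-- The tree language recognized by `M`. -/
def language {A : RankedAlphabet.{u}} (M : BottomUpAutomaton A) : Set (Tree A) :=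
  {t | M.run t ∈ M.final}

end BottomUpAutomaton

/-- Recognizable (regular) tree languages. -/
def Recognizable {A : RankedAlphabet.{u}} (L : Set (Tree A)) : Prop :=
  ∃ M : BottomUpAutomaton A, M.language = L

/-- What a look-ahead rule `(q[a[x₁ ⋯ x_k]] → rhs, range)` prescribes besides its left hand side:
the right hand side, a tree in `T_B(Q[{x₁, …, x_k}])`, where the leaf `(p, i)` stands for `p[x_i]`,
and the range of every variable. -/
@[ext]
structure RuleBody (Q : Type u) (A B : RankedAlphabet.{u}) (k : ℕ) : Type u where
  rhs : IndexedTree B (Q × Fin k)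
  range : Fin k → Set (Tree A)

/-- A top-down finite tree transducer with regular look-ahead, with input alphabet `A` and output
alphabet `B`.  `rules q a` is the set of rules with left hand side `q[a[x₁ ⋯ x_k]]`
(`q[a]` if `k = 0`); as there are finitely many left hand sides, finiteness of all these sets is
finiteness of the whole set of rules. -/
structure Transducer (A B : RankedAlphabet.{u}) : Type (u + 1) where
  State : Type u
  finite_state : Finite State
  rules : {k : ℕ} → State → A.Sym k → Set (RuleBody State A B k)
  finite_rules : ∀ {k : ℕ} (q : State) (a : A.Sym k), (rules q a).Finite
  recognizable_range : ∀ {k : ℕ} (q : State) (a : A.Sym k), ∀ r ∈ rules q a, ∀ i : Fin k,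
    Recognizable (r.range i)
  initial : Set State

/-- Tree transformations from `T_A` into `T_B`: subsets of `T_A × T_B`. -/
abbrev Transformation (A B : RankedAlphabet.{u}) : Type u := SetRel (Tree A) (Tree B)

namespace Transducer

/-- Configurations: trees in `T_B(Q[T_A])`, the leaf `(q, s)` standing for `q[s]`. -/
abbrev Config {A B : RankedAlphabet.{u}} (M : Transducer A B) : Type u :=
  IndexedTree B (M.State × Tree A)

/-- One rewriting step: somewhere in the configuration, `q[a[φ₁ ⋯ φ_k]]` is replaced by the right
hand side of a rule for `q` and `a`, with `φ_i` substituted for `x_i`, provided that every `φ_i`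
belongs to the range of `x_i` in that rule. -/
inductive Step {A B : RankedAlphabet.{u}} (M : Transducer A B) : M.Config → M.Config → Prop
  | rule {k : ℕ} (q : M.State) (a : A.Sym k) (r : RuleBody M.State A B k) (φ : Fin k → Tree A)
      (hr : r ∈ M.rules q a) (hφ : ∀ i, φ i ∈ r.range i) :
      Step M (.idx (q, .node a φ)) (r.rhs.subst fun p => .idx (p.1, φ p.2))
  | inside {k : ℕ} (b : B.Sym k) (ts : Fin k → M.Config) (i : Fin k) (t' : M.Config)
      (h : Step M (ts i) t') :
      Step M (.node b ts) (.node b (Function.update ts i t'))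

/-- The tree transformation realized by `M`. -/
def transformation {A B : RankedAlphabet.{u}} (M : Transducer A B) : Transformation A B :=
  {p | ∃ q ∈ M.initial,
    Relation.ReflTransGen M.Step (.idx (q, p.1)) (Tree.incl (M.State × Tree A) p.2)}

/-- `M` is linear: in every right hand side each variable occurs at most once. -/
def IsLinear {A B : RankedAlphabet.{u}} (M : Transducer A B) : Prop :=
  ∀ {k : ℕ} (q : M.State) (a : A.Sym k), ∀ r ∈ M.rules q a, ∀ i : Fin k,
    r.rhs.count (fun p => p.2 = i) ≤ 1

/-- `M` is (partial) deterministic: it has exactly one initial state, and any two different rules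
with the same left hand side have disjoint ranges for some variable. -/
def IsDeterministic {A B : RankedAlphabet.{u}} (M : Transducer A B) : Prop :=
  (∃ q, M.initial = {q}) ∧
  ∀ {k : ℕ} (q : M.State) (a : A.Sym k), ∀ r₁ ∈ M.rules q a, ∀ r₂ ∈ M.rules q a, r₁ ≠ r₂ →
    ∃ i : Fin k, r₁.range i ∩ r₂.range i = ∅

end Transducer

/-- Classes of tree transformations; `F ≤ G` is inclusion of classes. -/
abbrev TransformationClass : Type (u + 1) :=
  (A B : RankedAlphabet.{u}) → Set (Transformation A B)

/-- Composition of classes: all compositions of some `R₁` in `F` with some `R₂` in `G`, where `R₁`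
is applied first. -/
def TransformationClass.comp (F G : TransformationClass.{u}) : TransformationClass.{u} :=
  fun A C => {R | ∃ (B : RankedAlphabet.{u}) (R₁ : Transformation A B) (R₂ : Transformation B C),
    R₁ ∈ F A B ∧ R₂ ∈ G B C ∧ R = R₁.comp R₂}

/-- The class of top-down tree transformations with regular look-ahead. -/
def TR : TransformationClass.{u} :=
  fun A B => {R | ∃ M : Transducer A B, M.transformation = R}

/-- The class of linear top-down tree transformations with regular look-ahead. -/
def LTR : TransformationClass.{u} :=
  fun A B => {R | ∃ M : Transducer A B, M.IsLinear ∧ M.transformation = R}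

/-- The class of deterministic top-down tree transformations with regular look-ahead. -/
def DTR : TransformationClass.{u} :=
  fun A B => {R | ∃ M : Transducer A B, M.IsDeterministic ∧ M.transformation = R}

end TreeTransducer

/-! The composition runs `M₂` on the right-hand sides of the rules of `M₁`. Where `M₂` reaches a
leaf q₁[x_i] in state q₂, the composed machine calls itself on x_i with a state that pairs q₁ and
q₂. Two difficulties arise.

The look-ahead of `M₂` inspects parts of the intermediate tree that `M₁` has not yet produced. It
depends only on the states of a bottom-up automaton `P`, so a rule guesses the `P`-state of the tree
to be produced at each leaf (`annotations`). The guess binds later computation through a third state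
component, here a singleton. The look-ahead of the composition checks that each guess is realizable,
also at leaves that `M₂` erases. This check is regular by `exists_saturates_outDomain`.

If `M₂` copies a leaf, the copies could be translated from different outputs of `M₁`. A linear `M₂`
makes no copies (`exists_choice_of_linear`), and a deterministic `M₁` has at most one output. In
both cases `mem_outIndexed_iff` shows the simulation to be exact. If both machines are
deterministic, the input tree forces the rule, the guess and the run of `M₂`, hence the composed
rule. -/

namespace TreeTransducer

/-! ### Set-valued substitution into trees. -/

namespace IndexedTree

variable {A : RankedAlphabet.{u}} {S : Type v} {S' : Type w} {S'' : Type*}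

/-- Replace every occurrence of a leaf `s` by some tree in `R s`, different occurrences being
treated independently. -/
def substSet (R : S → Set (IndexedTree A S')) : IndexedTree A S → Set (IndexedTree A S')
  | idx s => R s
  | node a ts => {t | ∃ us, (∀ i, us i ∈ substSet R (ts i)) ∧ t = node a us}

/-- The elements of `S` that occur in an indexed tree. -/
def leaves : IndexedTree A S → Set S
  | idx s => {s}
  | node _ ts => {s | ∃ i, s ∈ leaves (ts i)}

theorem substSet_mono_of_leaves {R R' : S → Set (IndexedTree A S')} (r : IndexedTree A S)
    (h : ∀ s ∈ r.leaves, R s ⊆ R' s) : r.substSet R ⊆ r.substSet R' := by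
  induction r with
  | idx s => exact h s rfl
  | node a ts ih =>
    rintro _ ⟨us, hus, rfl⟩
    exact ⟨us, fun i => ih i (fun s hs => h s ⟨i, hs⟩) (hus i), rfl⟩

theorem substSet_mono {R R' : S → Set (IndexedTree A S')} (h : ∀ s, R s ⊆ R' s)
    (r : IndexedTree A S) : r.substSet R ⊆ r.substSet R' :=
  substSet_mono_of_leaves r fun s _ => h s

theorem mem_substSet_substSet {R : S → Set (IndexedTree A S')}
    {R' : S' → Set (IndexedTree A S'')} (r : IndexedTree A S) (t : IndexedTree A S'') :
    t ∈ r.substSet (fun s => {x | ∃ y ∈ R s, x ∈ y.substSet R'}) ↔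
      ∃ y ∈ r.substSet R, t ∈ y.substSet R' := by
  induction r generalizing t with
  | idx s => rfl
  | node a ts ih =>
    constructor
    · rintro ⟨us, hus, rfl⟩
      choose ys hys hus using fun i => (ih i _).1 (hus i)
      exact ⟨node a ys, ⟨ys, hys, rfl⟩, us, hus, rfl⟩
    · rintro ⟨_, ⟨ys, hys, rfl⟩, us, hus, rfl⟩
      exact ⟨us, fun i => (ih i _).2 ⟨ys i, hys i, hus i⟩, rfl⟩

theorem substSet_subst (f : S → IndexedTree A S') (R : S' → Set (IndexedTree A S''))
    (r : IndexedTree A S) :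
    (r.subst f).substSet R = r.substSet (fun s => (f s).substSet R) := by
  induction r with
  | idx s => rfl
  | node a ts ih => simp only [subst, substSet, ih]

theorem substSet_incl (R : S → Set (Tree A)) (t : Tree A) :
    (Tree.incl S t).substSet R = {t} := by
  induction t with
  | idx e => exact e.elim
  | node a ts ih =>
    ext x
    change (∃ us, (∀ i, us i ∈ (Tree.incl S (ts i)).substSet R) ∧ x = node a us) ↔ _
    simp only [ih, Set.mem_singleton_iff]
    exact ⟨fun ⟨us, h, hx⟩ => by rw [hx, funext h], fun hx => ⟨ts, fun _ => rfl, hx⟩⟩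

theorem substSet_subsingleton {R : S → Set (IndexedTree A S')} (h : ∀ s, (R s).Subsingleton)
    (r : IndexedTree A S) : (r.substSet R).Subsingleton := by
  induction r with
  | idx s => exact h s
  | node a ts ih =>
    rintro _ ⟨us, hus, rfl⟩ _ ⟨vs, hvs, rfl⟩
    rw [funext fun i => ih i (hus i) (hvs i)]

theorem substSet_finite {R : S → Set (IndexedTree A S')} (h : ∀ s, (R s).Finite)
    (r : IndexedTree A S) : (r.substSet R).Finite := by
  induction r with
  | idx s => exact h s
  | node a ts ih =>
    refine ((Set.Finite.pi' ih).image (node a)).subset ?_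
    rintro _ ⟨us, hus, rfl⟩
    exact ⟨us, hus, rfl⟩

theorem substSet_nonempty_iff {R : S → Set (IndexedTree A S')} (r : IndexedTree A S) :
    (r.substSet R).Nonempty ↔ ∀ s ∈ r.leaves, (R s).Nonempty := by
  induction r with
  | idx s => exact ⟨fun h _ hs => hs ▸ h, fun h => h s rfl⟩
  | node a ts ih =>
    constructor
    · rintro ⟨_, us, hus, rfl⟩ s ⟨i, hs⟩
      exact (ih i).1 ⟨_, hus i⟩ s hs
    · intro h
      choose us hus using fun i => (ih i).2 fun s hs => h s ⟨i, hs⟩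
      exact ⟨_, us, hus, rfl⟩

theorem mem_substSet_of_leaves {R : S → Set (IndexedTree A S')} {G : S' → Prop}
    {r : IndexedTree A S} {t : IndexedTree A S'} (ht : t ∈ r.substSet R)
    (hG : ∀ s ∈ t.leaves, G s) :
    t ∈ r.substSet (fun s => {x | x ∈ R s ∧ ∀ y ∈ x.leaves, G y}) := by
  induction r generalizing t with
  | idx s => exact ⟨ht, hG⟩
  | node a ts ih =>
    obtain ⟨us, hus, rfl⟩ := ht
    exact ⟨us, fun i => ih i (hus i) fun s hs => hG s ⟨i, hs⟩, rfl⟩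

theorem one_le_count {P : S → Prop} {s : S} (hs : P s) (r : IndexedTree A S)
    (h : s ∈ r.leaves) : 1 ≤ r.count P := by
  induction r with
  | idx x =>
    obtain rfl : s = x := h
    simp [count, hs]
  | node a ts ih =>
    obtain ⟨i, hi⟩ := h
    exact (ih i hi).trans (Finset.single_le_sum (f := fun i => (ts i).count P)
      (fun _ _ => Nat.zero_le _) (Finset.mem_univ i))

/-- In a tree in which every variable occurs at most once, the choices made at the leaves can be
made once for every variable. -/
theorem exists_choice_of_linear {Q X : Type u} {k : ℕ} (r : IndexedTree A (Q × Fin k))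
    (hr : ∀ i, r.count (fun p => p.2 = i) ≤ 1) (V : Fin k → Set X) (hV : ∀ i, (V i).Nonempty)
    (W : Q → X → Set (IndexedTree A S')) (t : IndexedTree A S')
    (ht : t ∈ r.substSet (fun p => {x | ∃ u ∈ V p.2, x ∈ W p.1 u})) :
    ∃ u : Fin k → X, (∀ i, u i ∈ V i) ∧ t ∈ r.substSet (fun p => W p.1 (u p.2)) := by
  classical
  choose d hd using hV
  induction r generalizing t with
  | idx p =>
    obtain ⟨u, hu, ht⟩ := ht
    refine ⟨Function.update d p.2 u, fun i => ?_, ?_⟩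
    · rcases eq_or_ne i p.2 with rfl | h
      · simpa using hu
      · simpa [h] using hd i
    · simpa [substSet] using ht
  | node a ts ih =>
    obtain ⟨us, hus, rfl⟩ := ht
    have hle : ∀ i j, (ts j).count (fun p => p.2 = i) ≤ 1 := fun i j =>
      (Finset.single_le_sum (f := fun j => (ts j).count (fun p => p.2 = i))
        (fun _ _ => Nat.zero_le _) (Finset.mem_univ j)).trans (hr i)
    choose v hv hvt using fun j => ih j (fun i => hle i j) (us j) (hus j)
    -- Two different subtrees containing the variable `i` would contribute at least 2 to its count.
    -- Hence the choice for `i` can be copied from the only subtree that contains it; absent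
    -- variables get the default `d`.
    have huniq : ∀ i j j' q q', (q, i) ∈ (ts j).leaves → (q', i) ∈ (ts j').leaves → j = j' := by
      intro i j j' q q' h h'
      by_contra hne
      have h1 := one_le_count (P := fun p : Q × Fin k => p.2 = i) rfl _ h
      have h2 := one_le_count (P := fun p : Q × Fin k => p.2 = i) rfl _ h'
      have h3 : ∑ x ∈ {j, j'}, (ts x).count (fun p => p.2 = i) ≤ 1 :=
        (Finset.sum_le_sum_of_subset (Finset.subset_univ _)).trans (hr i)
      rw [Finset.sum_pair hne] at h3
      omega
    refine ⟨fun i => if h : ∃ j q, (q, i) ∈ (ts j).leaves then v h.choose i else d i,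
      fun i => ?_, us, fun j => ?_, rfl⟩
    · dsimp only
      split_ifs with h
      · exact hv _ i
      · exact hd i
    · refine substSet_mono_of_leaves _ ?_ (hvt j)
      rintro ⟨q, i⟩ hqi
      have h : ∃ j q, (q, i) ∈ (ts j).leaves := ⟨j, q, hqi⟩
      have hj : h.choose = j := huniq i _ _ _ _ h.choose_spec.choose_spec hqi
      simp only [dif_pos h, hj]
      exact subset_rfl

end IndexedTree

/-! ### Saturating automata and annotations by states. -/

namespace BottomUpAutomaton

variable {A : RankedAlphabet.{u}} {S : Type u}

/-- `P` saturates `L` if membership in `L` depends only on the state reached by `P`. -/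
def Saturates (P : BottomUpAutomaton A) (L : Set (Tree A)) : Prop :=
  ∀ s t, P.run s = P.run t → s ∈ L → t ∈ L

theorem Saturates.mem_iff {P : BottomUpAutomaton A} {L : Set (Tree A)} (h : P.Saturates L)
    (t : Tree A) : P.run t ∈ P.run '' L ↔ t ∈ L :=
  ⟨fun ⟨s, hs, e⟩ => h s t e hs, fun ht => ⟨t, ht, rfl⟩⟩

theorem Saturates.recognizable {P : BottomUpAutomaton A} {L : Set (Tree A)}
    (h : P.Saturates L) : Recognizable L :=
  ⟨{ P with final := P.run '' L }, by
    have hrun : ∀ t, BottomUpAutomaton.run { P with final := P.run '' L } t = P.run t := by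
      intro t
      induction t with
      | idx e => exact e.elim
      | node a ts ih => simp only [run, ih]
    ext t
    simp only [language, Set.mem_ofPred_eq, hrun]
    exact h.mem_iff t⟩

/-- Finitely many recognizable languages are saturated by a common automaton. -/
theorem exists_saturates {ι : Type u} [Finite ι] (L : ι → Set (Tree A))
    (h : ∀ i, Recognizable (L i)) : ∃ P : BottomUpAutomaton A, ∀ i, P.Saturates (L i) := by
  choose M hM using h
  have := fun i => (M i).finite_state
  let P : BottomUpAutomaton A :=
    { State := ∀ i, (M i).State
      finite_state := inferInstance
      trans := fun a f i => (M i).trans a fun j => f j i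
      -- Saturation refers to `run` only, so any set of final states would do.
      final := ∅ }
  have hrun : ∀ t i, P.run t i = (M i).run t := by
    intro t
    induction t with
    | idx e => exact e.elim
    | node a ts ih =>
      intro i
      simp only [run, ← ih]
      rfl
  refine ⟨P, fun i s t hst hs => ?_⟩
  rw [← hM i] at hs ⊢
  change (M i).run t ∈ (M i).final
  rw [← hrun, ← hst, hrun]
  exact hs

/-- The state reached on an indexed tree whose leaves `s` are assigned states `st s`. -/
def eval (P : BottomUpAutomaton A) (st : S → P.State) : IndexedTree A S → P.State
  | .idx s => st s
  | .node a ts => P.trans a fun i => P.eval st (ts i)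

theorem run_eq_eval (P : BottomUpAutomaton A) {st : S → P.State} {U : S → Set (Tree A)}
    (hU : ∀ s, ∀ u ∈ U s, P.run u = st s) (ζ : IndexedTree A S) (u : Tree A)
    (hu : u ∈ ζ.substSet U) : P.run u = P.eval st ζ := by
  induction ζ generalizing u with
  | idx s => exact hU s u hu
  | node a ts ih =>
    obtain ⟨us, hus, rfl⟩ := hu
    simp only [run, eval, fun i => ih i (us i) (hus i)]

/-- All ways of annotating the leaves of a tree by states of `P`. -/
def annotations (P : BottomUpAutomaton A) (r : IndexedTree A S) :
    Set (IndexedTree A (S × P.State)) :=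
  r.substSet fun s => Set.range fun p => .idx (s, p)

theorem annotations_finite (P : BottomUpAutomaton A) (r : IndexedTree A S) :
    (P.annotations r).Finite :=
  have := P.finite_state
  r.substSet_finite fun _ => Set.finite_range _

/-- Every substituted piece has exactly one `P`-state; recording it at its leaf gives the
annotation. -/
theorem mem_substSet_iff_annotations (P : BottomUpAutomaton A) (V : S → Set (Tree A))
    (r : IndexedTree A S) (u : Tree A) :
    u ∈ r.substSet V ↔
      ∃ ζ ∈ P.annotations r, u ∈ ζ.substSet fun x => {u | u ∈ V x.1 ∧ P.run u = x.2} := by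
  rw [annotations, ← IndexedTree.mem_substSet_substSet]
  have : V = fun s => {x | ∃ y ∈ Set.range fun p : P.State => IndexedTree.idx (s, p),
      x ∈ y.substSet fun x => {u | u ∈ V x.1 ∧ P.run u = x.2}} := by
    ext s x
    constructor
    · exact fun h => ⟨_, ⟨P.run x, rfl⟩, h, rfl⟩
    · rintro ⟨_, ⟨p, rfl⟩, h, -⟩
      exact h
  rw [← this]

/-- An annotation is determined by a functional constraint on its leaves. -/
theorem annotations_unique (P : BottomUpAutomaton A) {G : S → P.State → Prop}
    (hG : ∀ s p p', G s p → G s p' → p = p') {r : IndexedTree A S}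
    {ζ ζ' : IndexedTree A (S × P.State)} (h : ζ ∈ P.annotations r) (h' : ζ' ∈ P.annotations r)
    (hζ : ∀ x ∈ ζ.leaves, G x.1 x.2) (hζ' : ∀ x ∈ ζ'.leaves, G x.1 x.2) : ζ = ζ' := by
  refine IndexedTree.substSet_subsingleton ?_ r (IndexedTree.mem_substSet_of_leaves h hζ)
    (IndexedTree.mem_substSet_of_leaves h' hζ')
  rintro s _ ⟨⟨p, rfl⟩, hp⟩ _ ⟨⟨p', rfl⟩, hp'⟩
  rw [hG s p p' (hp _ rfl) (hp' _ rfl)]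

end BottomUpAutomaton

/-! ### Recursive semantics of transducers, equivalent to rewriting. -/

namespace Transducer

variable {A B C : RankedAlphabet.{u}}

/-- `M.out s q` is the set of trees produced from `q[s]`. -/
def out (M : Transducer A B) : Tree A → M.State → Set (Tree B)
  | .idx e, _ => e.elim
  | .node a φ, q => {t | ∃ r ∈ M.rules q a, (∀ i, φ i ∈ r.range i) ∧
      t ∈ r.rhs.substSet fun p => M.out (φ p.2) p.1}

/-- A step commits to one rule at one leaf, so it can only shrink the set of trees still obtainable.
A finished tree yields only itself, which turns derivations into membership in `out`. -/
theorem Step.substSet_out_subset {M : Transducer A B} {c c' : M.Config} (h : M.Step c c') :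
    c'.substSet (fun p => M.out p.2 p.1) ⊆ c.substSet (fun p => M.out p.2 p.1) := by
  induction h with
  | rule q a r φ hr hφ =>
    intro t ht
    rw [IndexedTree.substSet_subst] at ht
    exact ⟨r, hr, hφ, ht⟩
  | inside b ts i t' h ih =>
    rintro _ ⟨us, hus, rfl⟩
    refine ⟨us, fun j => ?_, rfl⟩
    have := hus j
    rcases eq_or_ne j i with rfl | hj
    · rw [Function.update_self] at this
      exact ih this
    · rwa [Function.update_of_ne hj] at this

theorem reflTransGen_node {M : Transducer A B} {k : ℕ} (b : B.Sym k) (ts us : Fin k → M.Config)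
    (h : ∀ i, Relation.ReflTransGen M.Step (ts i) (us i)) :
    Relation.ReflTransGen M.Step (.node b ts) (.node b us) := by
  classical
  have single : ∀ (ts : Fin k → M.Config) i t',
      Relation.ReflTransGen M.Step (ts i) t' →
        Relation.ReflTransGen M.Step (.node b ts) (.node b (Function.update ts i t')) := by
    intro ts i t' h
    induction h with
    | refl => rw [Function.update_eq_self]
    | tail _ hstep ih =>
      refine ih.tail ?_
      have := Step.inside (M := M) b (Function.update ts i _) i _
        (by rw [Function.update_self]; exact hstep)
      rwa [Function.update_idem] at this
  -- A step changes a single child, so the children are rewritten one after another.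
  have main : ∀ s : Finset (Fin k),
      Relation.ReflTransGen M.Step (.node b ts) (.node b (s.piecewise us ts)) := by
    intro s
    induction s using Finset.induction_on with
    | empty => rw [Finset.piecewise_empty]
    | insert i s hi ih =>
      rw [Finset.piecewise_insert]
      refine ih.trans (single _ _ _ ?_)
      rw [Finset.piecewise_eq_of_notMem _ _ _ hi]
      exact h i
  simpa using main Finset.univ

theorem reflTransGen_of_mem_substSet {M : Transducer A B} {S : Type u} (f : S → M.Config)
    (R : S → Set (Tree B)) (hf : ∀ s, ∀ t ∈ R s,
      Relation.ReflTransGen M.Step (f s) (Tree.incl (M.State × Tree A) t))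
    (c : IndexedTree B S) (t : Tree B) (ht : t ∈ c.substSet R) :
    Relation.ReflTransGen M.Step (c.subst f) (Tree.incl (M.State × Tree A) t) := by
  induction c generalizing t with
  | idx s => exact hf s t ht
  | node b ts ih =>
    obtain ⟨us, hus, rfl⟩ := ht
    exact reflTransGen_node b _ _ fun i => ih i _ (hus i)

theorem reflTransGen_of_mem_out {M : Transducer A B} (s : Tree A) (q : M.State) (t : Tree B)
    (ht : t ∈ M.out s q) :
    Relation.ReflTransGen M.Step (.idx (q, s)) (Tree.incl (M.State × Tree A) t) := by
  induction s generalizing q t with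
  | idx e => exact e.elim
  | node a φ ih =>
    obtain ⟨r, hr, hφ, ht⟩ := ht
    exact .head (Step.rule q a r φ hr hφ)
      (reflTransGen_of_mem_substSet _ _ (fun p t ht => ih p.2 p.1 t ht) _ _ ht)

theorem mem_transformation_iff (M : Transducer A B) (s : Tree A) (t : Tree B) :
    (s, t) ∈ M.transformation ↔ ∃ q ∈ M.initial, t ∈ M.out s q := by
  refine exists_congr fun q => and_congr_right fun _ =>
    ⟨fun h => ?_, reflTransGen_of_mem_out s q t⟩
  have key : ∀ c c' : M.Config, Relation.ReflTransGen M.Step c c' →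
      c'.substSet (fun p => M.out p.2 p.1) ⊆ c.substSet (fun p => M.out p.2 p.1) := by
    intro c c' h
    induction h with
    | refl => exact subset_rfl
    | tail _ h ih => exact h.substSet_out_subset.trans ih
  refine key _ _ h ?_
  rw [IndexedTree.substSet_incl]
  rfl

theorem IsDeterministic.out_subsingleton {M : Transducer A B} (hM : M.IsDeterministic)
    (s : Tree A) (q : M.State) : (M.out s q).Subsingleton := by
  induction s generalizing q with
  | idx e => exact e.elim
  | node a φ ih =>
    rintro t ⟨r, hr, hφ, ht⟩ t' ⟨r', hr', hφ', ht'⟩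
    obtain rfl : r = r' := by
      by_contra hne
      obtain ⟨i, hi⟩ := hM.2 q a r hr r' hr' hne
      exact hi.subset ⟨hφ i, hφ' i⟩
    exact IndexedTree.substSet_subsingleton (S := M.State × Fin _) (fun p => ih p.2 p.1) _ ht ht'

/-- `P` saturates all look-ahead languages of `M`. -/
def LookaheadAutomaton (M : Transducer A B) (P : BottomUpAutomaton A) : Prop :=
  ∀ {k : ℕ} (q : M.State) (a : A.Sym k), ∀ r ∈ M.rules q a, ∀ i, P.Saturates (r.range i)

theorem exists_lookaheadAutomaton (M : Transducer A B) : ∃ P, M.LookaheadAutomaton P := by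
  have := M.finite_state
  have := A.finite_sym
  have := fun (x : Σ k, A.Sym k) (q : M.State) => (M.finite_rules q x.2).to_subtype
  obtain ⟨P, hP⟩ := BottomUpAutomaton.exists_saturates
    (ι := Σ (x : Σ k, A.Sym k) (q : M.State) (_ : M.rules q x.2), Fin x.1)
    (fun y => y.2.2.1.1.range y.2.2.2)
    (fun y => M.recognizable_range _ _ _ y.2.2.1.2 _)
  exact ⟨P, fun q a r hr i => hP ⟨⟨_, a⟩, q, ⟨r, hr⟩, i⟩⟩

/-! ### Running a transducer on trees with unknown subtrees. -/

section Indexed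

variable (M : Transducer B C) (P : BottomUpAutomaton B) {S : Type u} {X : Type v} {Y : Type w} (st : S → P.State)

/-- The trees produced by `M` in state `q` from an indexed tree, where the leaves `s` are known
only through their states `st s` in the look-ahead automaton `P`, and `base s q` is the set of
trees produced from `q[s]`. -/
def outIndexed (base : S → M.State → Set (IndexedTree C X)) :
    IndexedTree B S → M.State → Set (IndexedTree C X)
  | .idx s, q => base s q
  | .node b ts, q => {t | ∃ r ∈ M.rules q b, (∀ i, P.eval st (ts i) ∈ P.run '' r.range i) ∧
      t ∈ r.rhs.substSet fun p => outIndexed base (ts p.2) p.1}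

/-- This separates building a right-hand side, with symbolic leaves, from expanding those leaves
later. -/
theorem mem_outIndexed_substSet (base : S → M.State → Set (IndexedTree C X))
    (R : X → Set (IndexedTree C Y)) (ζ : IndexedTree B S) (q : M.State) (t : IndexedTree C Y) :
    t ∈ M.outIndexed P st (fun s q => {x | ∃ y ∈ base s q, x ∈ y.substSet R}) ζ q ↔
      ∃ y ∈ M.outIndexed P st base ζ q, t ∈ y.substSet R := by
  induction ζ generalizing q t with
  | idx s => rfl
  | node b ts ih =>
    have : ∀ r : IndexedTree C (M.State × Fin _), r.substSet (fun p => M.outIndexed P st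
        (fun s q => {x | ∃ y ∈ base s q, x ∈ y.substSet R}) (ts p.2) p.1) = r.substSet
        (fun p => {x | ∃ y ∈ M.outIndexed P st base (ts p.2) p.1, x ∈ y.substSet R}) := by
      intro r
      congr 1
      ext p x
      exact ih _ _ _
    constructor
    · rintro ⟨r, hr, hl, ht⟩
      rw [this, IndexedTree.mem_substSet_substSet] at ht
      obtain ⟨y, hy, ht⟩ := ht
      exact ⟨y, ⟨r, hr, hl, hy⟩, ht⟩
    · rintro ⟨y, ⟨r, hr, hl, hy⟩, ht⟩
      refine ⟨r, hr, hl, ?_⟩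
      rw [this, IndexedTree.mem_substSet_substSet]
      exact ⟨y, hy, ht⟩

theorem outIndexed_finite {base : S → M.State → Set (IndexedTree C X)}
    (h : ∀ s q, (base s q).Finite) (ζ : IndexedTree B S) (q : M.State) :
    (M.outIndexed P st base ζ q).Finite := by
  induction ζ generalizing q with
  | idx s => exact h s q
  | node b ts ih =>
    refine ((M.finite_rules q b).biUnion fun r _ =>
      r.rhs.substSet_finite fun p => ih p.2 p.1).subset ?_
    rintro t ⟨r, hr, -, ht⟩
    exact Set.mem_biUnion hr ht

variable {M P st}

/-- Rules passing the test on states need not share a witness tree a priori; saturation moves a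
witness of one range into the other, contradicting disjointness. -/
theorem IsDeterministic.outIndexed_subsingleton (hM : M.IsDeterministic)
    (hP : M.LookaheadAutomaton P) {base : S → M.State → Set (IndexedTree C X)}
    (h : ∀ s q, (base s q).Subsingleton) (ζ : IndexedTree B S) (q : M.State) :
    (M.outIndexed P st base ζ q).Subsingleton := by
  induction ζ generalizing q with
  | idx s => exact h s q
  | node b ts ih =>
    rintro t ⟨r, hr, hl, ht⟩ t' ⟨r', hr', hl', ht'⟩
    obtain rfl : r = r' := by
      by_contra hne
      obtain ⟨i, hi⟩ := hM.2 q b r hr r' hr' hne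
      obtain ⟨x, hx, ex⟩ := hl i
      obtain ⟨y, hy, ey⟩ := hl' i
      exact hi.subset ⟨hx, hP q b r' hr' i y x (ey.trans ex.symm) hy⟩
    exact IndexedTree.substSet_subsingleton (S := M.State × Fin _) (fun p => ih p.2 p.1) _ ht ht'

/-- Running `M` on an indexed tree amounts to running it on the trees obtained by substitution, if
`M` is linear or there is no choice in the substitution. -/
theorem mem_outIndexed_iff (hP : M.LookaheadAutomaton P) {U : S → Set (Tree B)}
    (hU : ∀ s, ∀ u ∈ U s, P.run u = st s) (hM : M.IsLinear ∨ ∀ s, (U s).Subsingleton)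
    (ζ : IndexedTree B S) (hζ : ∀ s ∈ ζ.leaves, (U s).Nonempty) (q : M.State) (t : Tree C) :
    t ∈ M.outIndexed P st (fun s q => {t | ∃ u ∈ U s, t ∈ M.out u q}) ζ q ↔
      ∃ u ∈ ζ.substSet U, t ∈ M.out u q := by
  induction ζ generalizing q t with
  | idx s => rfl
  | node b ts ih =>
    have hζ' : ∀ i, ∀ s ∈ (ts i).leaves, (U s).Nonempty := fun i s hs => hζ s ⟨i, hs⟩
    have look : ∀ r ∈ M.rules q b, ∀ i, ∀ u ∈ (ts i).substSet U,
        (P.eval st (ts i) ∈ P.run '' r.range i ↔ u ∈ r.range i) := by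
      intro r hr i u hu
      rw [← (hP q b r hr i).mem_iff, P.run_eq_eval hU _ u hu]
    constructor
    · rintro ⟨r, hr, hl, ht⟩
      have ht' : t ∈ r.rhs.substSet
          (fun p => {x | ∃ u ∈ (ts p.2).substSet U, x ∈ M.out u p.1}) :=
        IndexedTree.substSet_mono (fun p x hx => (ih p.2 (hζ' _) _ _).1 hx) _ ht
      -- Children that `r` erases must still be completed to trees, which is why all leaves of `ζ`
      -- need outputs.
      have hV : ∀ i, ((ts i).substSet U).Nonempty := fun i =>
        (IndexedTree.substSet_nonempty_iff _).2 (hζ' i)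
      obtain ⟨us, hus, h⟩ : ∃ us : Fin _ → Tree B, (∀ i, us i ∈ (ts i).substSet U) ∧
          t ∈ r.rhs.substSet (fun p => M.out (us p.2) p.1) := by
        -- So far each occurrence of a variable may use its own tree; one common tree per variable
        -- is needed.
        rcases hM with hM | hM
        · exact IndexedTree.exists_choice_of_linear r.rhs (hM q b r hr)
            (fun i => (ts i).substSet U) hV (fun q u => M.out u q) t ht'
        · choose us hus using hV
          refine ⟨us, hus, IndexedTree.substSet_mono ?_ _ ht'⟩
          rintro p x ⟨u, hu, hx⟩
          rwa [IndexedTree.substSet_subsingleton hM _ (hus p.2) hu]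
      exact ⟨.node b us, ⟨us, hus, rfl⟩, r, hr,
        fun i => (look r hr i _ (hus i)).1 (hl i), h⟩
    · rintro ⟨_, ⟨us, hus, rfl⟩, r, hr, hl, ht⟩
      exact ⟨r, hr, fun i => (look r hr i _ (hus i)).2 (hl i),
        IndexedTree.substSet_mono (fun p x hx => (ih p.2 (hζ' _) _ _).2 ⟨us p.2, hus _, hx⟩) _ ht⟩

end Indexed

/-! ### Regularity of inverse images of state languages. -/

/-- The input trees from which `M` in state `q` can produce a tree with `P`-state `p`. -/
def outDomain (M : Transducer A B) (P : BottomUpAutomaton B) (q : M.State) (p : P.State) :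
    Set (Tree A) :=
  {s | ∃ u ∈ M.out s q, P.run u = p}

/-- The leaves of an annotated right hand side, with the trees that they may produce. -/
def leafOut (M : Transducer A B) (P : BottomUpAutomaton B) {k : ℕ} (φ : Fin k → Tree A)
    (x : (M.State × Fin k) × P.State) : Set (Tree B) :=
  {u | u ∈ M.out (φ x.1.2) x.1.1 ∧ P.run u = x.2}

/-- Occurrences of leaves produce their trees independently, so an annotation is realizable as soon
as each leaf is. Thus the reachable `P`-states are determined by those reachable at the children. -/
theorem exists_run_eq_iff_annotations (M : Transducer A B) (P : BottomUpAutomaton B) {k : ℕ}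
    (φ : Fin k → Tree A) (r : IndexedTree B (M.State × Fin k)) (p : P.State) :
    (∃ u ∈ r.substSet (fun y => M.out (φ y.2) y.1), P.run u = p) ↔
      ∃ ζ ∈ P.annotations r,
        (∀ x ∈ ζ.leaves, φ x.1.2 ∈ M.outDomain P x.1.1 x.2) ∧ P.eval Prod.snd ζ = p := by
  have hU : ∀ x, ∀ u ∈ M.leafOut P φ x, P.run u = x.2 := fun x u hu => hu.2
  constructor
  · rintro ⟨u, hu, rfl⟩
    obtain ⟨ζ, hζ, hu⟩ := (P.mem_substSet_iff_annotations _ _ _).1 hu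
    exact ⟨ζ, hζ, (IndexedTree.substSet_nonempty_iff _).1 ⟨u, hu⟩,
      (P.run_eq_eval hU ζ u hu).symm⟩
  · rintro ⟨ζ, hζ, hl, rfl⟩
    obtain ⟨u, hu⟩ := (IndexedTree.substSet_nonempty_iff (R := M.leafOut P φ) ζ).2 hl
    exact ⟨u, (P.mem_substSet_iff_annotations _ _ _).2 ⟨ζ, hζ, hu⟩, P.run_eq_eval hU ζ u hu⟩

/-- The look-ahead languages of `M` and the inverse images of the state languages of `P` are
saturated by a common automaton. -/
theorem exists_saturates_outDomain (M : Transducer A B) (P : BottomUpAutomaton B) :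
    ∃ L : BottomUpAutomaton A, M.LookaheadAutomaton L ∧
      ∀ q p, L.Saturates (M.outDomain P q p) := by
  obtain ⟨D, hD⟩ := M.exists_lookaheadAutomaton
  have := M.finite_state
  have := P.finite_state
  have := D.finite_state
  let L : BottomUpAutomaton A :=
    -- Subset construction: the second component collects all pairs `(q, p)` such that `q` can
    -- produce a tree with state `p`.
    { State := D.State × Set (M.State × P.State)
      finite_state := inferInstance
      trans := fun a f => (D.trans a fun i => (f i).1,
        {y | ∃ r ∈ M.rules y.1 a, (∀ i, (f i).1 ∈ D.run '' r.range i) ∧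
          ∃ ζ ∈ P.annotations r.rhs, (∀ x ∈ ζ.leaves, (x.1.1, x.2) ∈ (f x.1.2).2) ∧
            P.eval Prod.snd ζ = y.2})
      final := ∅ }
  have hrun : ∀ s, L.run s = (D.run s, {y | s ∈ M.outDomain P y.1 y.2}) := by
    intro s
    induction s with
    | idx e => exact e.elim
    | node a φ ih =>
      simp only [BottomUpAutomaton.run, ih]
      refine Prod.ext rfl (Set.ext fun y => ?_)
      change (∃ r ∈ M.rules y.1 a, (∀ i, D.run (φ i) ∈ D.run '' r.range i) ∧ _) ↔ _
      constructor
      · rintro ⟨r, hr, hl, hζ⟩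
        obtain ⟨u, hu, hp⟩ := (M.exists_run_eq_iff_annotations P φ r.rhs y.2).2 hζ
        exact ⟨u, ⟨r, hr, fun i => ((hD _ a r hr i).mem_iff _).1 (hl i), hu⟩, hp⟩
      · rintro ⟨u, ⟨r, hr, hl, hu⟩, hp⟩
        exact ⟨r, hr, fun i => ((hD _ a r hr i).mem_iff _).2 (hl i),
          (M.exists_run_eq_iff_annotations P φ r.rhs y.2).1 ⟨u, hu, hp⟩⟩
  refine ⟨L, fun q a r hr i s t hst => ?_, fun q p s t hst hs => ?_⟩
  · rw [hrun, hrun] at hst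
    exact hD q a r hr i s t (congrArg Prod.fst hst)
  · rw [hrun, hrun] at hst
    exact (Set.ext_iff.1 (congrArg Prod.snd hst) (q, p)).1 hs

/-! ### The composed transducer and its correctness. -/

section Composition

variable (M₁ : Transducer A B) (M₂ : Transducer B C) (P : BottomUpAutomaton B)

/-- The ranges of the variables in a rule of the composition, which check those of the rule of
`M₁` and the states in an annotation of its right hand side. -/
def compRange {k : ℕ} (r : RuleBody M₁.State A B k)
    (ζ : IndexedTree B ((M₁.State × Fin k) × P.State)) (i : Fin k) : Set (Tree A) :=
  {s | s ∈ r.range i ∧ ∀ x ∈ ζ.leaves, x.1.2 = i → s ∈ M₁.outDomain P x.1.1 x.2}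

theorem forall_mem_compRange {k : ℕ} {r : RuleBody M₁.State A B k}
    {ζ : IndexedTree B ((M₁.State × Fin k) × P.State)} {φ : Fin k → Tree A} :
    (∀ i, φ i ∈ M₁.compRange P r ζ i) ↔
      (∀ i, φ i ∈ r.range i) ∧ ∀ x ∈ ζ.leaves, φ x.1.2 ∈ M₁.outDomain P x.1.1 x.2 :=
  ⟨fun h => ⟨fun i => (h i).1, fun x hx => (h x.1.2).2 x hx rfl⟩,
    fun h i => ⟨h.1 i, fun x hx e => e ▸ h.2 x hx⟩⟩

/-- States of the composition: states of `M₁` and `M₂`, and a set of admissible states of `P` for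
the intermediate tree. -/
abbrev CompState : Type u := M₁.State × M₂.State × Set P.State

/-- The right hand sides of the composition obtained by running `M₂` on an annotated right hand
side of `M₁`. -/
def compRhs {k : ℕ} (ζ : IndexedTree B ((M₁.State × Fin k) × P.State)) (q₂ : M₂.State) :
    Set (IndexedTree C (CompState M₁ M₂ P × Fin k)) :=
  M₂.outIndexed P Prod.snd (fun x q => {.idx ((x.1.1, q, {x.2}), x.1.2)}) ζ q₂

/-- The composition of `M₁` and `M₂`, where `P` is a look-ahead automaton for `M₂`. -/
def compose : Transducer A C where
  State := CompState M₁ M₂ P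
  finite_state :=
    have := M₁.finite_state
    have := M₂.finite_state
    have := P.finite_state
    inferInstance
  rules := fun q a => {b | ∃ r ∈ M₁.rules q.1 a, ∃ ζ ∈ P.annotations r.rhs,
    P.eval Prod.snd ζ ∈ q.2.2 ∧ ∃ t ∈ compRhs M₁ M₂ P ζ q.2.1, b = ⟨t, M₁.compRange P r ζ⟩}
  finite_rules := by
    intro k q a
    refine ((M₁.finite_rules q.1 a).biUnion fun r _ =>
      (P.annotations_finite r.rhs).biUnion fun ζ _ =>
        (M₂.outIndexed_finite P Prod.snd
          (base := fun x q => {IndexedTree.idx (((x.1.1, q, {x.2}) : CompState M₁ M₂ P), x.1.2)})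
          (fun _ _ => Set.finite_singleton _) ζ q.2.1).image
            fun t => (⟨t, M₁.compRange P r ζ⟩ : RuleBody _ A C k)).subset ?_
    rintro _ ⟨r, hr, ζ, hζ, -, t, ht, rfl⟩
    exact Set.mem_biUnion hr (Set.mem_biUnion hζ ⟨t, ht, rfl⟩)
  recognizable_range := by
    rintro k q a _ ⟨r, hr, ζ, -, -, t, -, rfl⟩ i
    obtain ⟨L, hL, hL'⟩ := M₁.exists_saturates_outDomain P
    refine BottomUpAutomaton.Saturates.recognizable (P := L) fun s s' e h => ⟨?_, ?_⟩
    · exact hL q.1 a r hr i s s' e h.1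
    · exact fun x hx hi => hL' _ _ s s' e (h.2 x hx hi)
  -- No guess has been made at the root, so every state of `P` is admissible.
  initial := {q | q.1 ∈ M₁.initial ∧ q.2.1 ∈ M₂.initial ∧ q.2.2 = Set.univ}

variable {M₁ M₂ P}

theorem mem_out_compose (hP : M₂.LookaheadAutomaton P)
    (h : M₂.IsLinear ∨ M₁.IsDeterministic) (s : Tree A) (q : CompState M₁ M₂ P) (t : Tree C) :
    t ∈ (compose M₁ M₂ P).out s q ↔
      ∃ u ∈ M₁.out s q.1, P.run u ∈ q.2.2 ∧ t ∈ M₂.out u q.2.1 := by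
  induction s generalizing q t with
  | idx e => exact e.elim
  | node a φ ih =>
    have hU : ∀ x, ∀ u ∈ M₁.leafOut P φ x, P.run u = x.2 := fun x u hu => hu.2
    have h' : M₂.IsLinear ∨ ∀ x, (M₁.leafOut P φ x).Subsingleton :=
      h.imp_right fun h x u hu v hv => h.out_subsingleton _ _ hu.1 hv.1
    -- The singleton `{x.2}` makes the induction hypothesis yield exactly the trees with the guessed
    -- state, that is, `leafOut`.
    have hbase : (fun (x : (M₁.State × Fin _) × P.State) (q : M₂.State) =>
        {t | ∃ y ∈ ({.idx ((x.1.1, q, {x.2}), x.1.2)} :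
            Set (IndexedTree C (CompState M₁ M₂ P × Fin _))),
          t ∈ y.substSet fun p => (compose M₁ M₂ P).out (φ p.2) p.1}) =
        fun x q => {t | ∃ u ∈ M₁.leafOut P φ x, t ∈ M₂.out u q} := by
      ext x q t
      simp only [Set.mem_singleton_iff, exists_eq_left, Set.mem_ofPred_eq, IndexedTree.substSet]
      refine (ih _ _ _).trans ?_
      simp only [leafOut, Set.mem_singleton_iff, Set.mem_ofPred_eq, and_assoc]
    have key : ∀ ζ : IndexedTree B ((M₁.State × Fin _) × P.State),
        (∀ x ∈ ζ.leaves, φ x.1.2 ∈ M₁.outDomain P x.1.1 x.2) → ((∃ y ∈ compRhs M₁ M₂ P ζ q.2.1,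
          t ∈ y.substSet fun p => (compose M₁ M₂ P).out (φ p.2) p.1) ↔
        ∃ u ∈ ζ.substSet (M₁.leafOut P φ), t ∈ M₂.out u q.2.1) := by
      intro ζ hζ
      rw [compRhs, ← mem_outIndexed_substSet, hbase]
      exact mem_outIndexed_iff hP hU h' ζ hζ _ _
    constructor
    · rintro ⟨_, ⟨r, hr, ζ, hζ, hK, y, hy, rfl⟩, hφ, ht⟩
      obtain ⟨hr', hl⟩ := (M₁.forall_mem_compRange P).1 hφ
      obtain ⟨u, hu, htu⟩ := (key ζ hl).1 ⟨y, hy, ht⟩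
      refine ⟨u, ⟨r, hr, hr', (P.mem_substSet_iff_annotations _ _ _).2 ⟨ζ, hζ, hu⟩⟩, ?_, htu⟩
      rwa [P.run_eq_eval hU ζ u hu]
    · rintro ⟨u, ⟨r, hr, hr', hu⟩, hK, htu⟩
      obtain ⟨ζ, hζ, hu⟩ := (P.mem_substSet_iff_annotations _ _ _).1 hu
      have hl : ∀ x ∈ ζ.leaves, φ x.1.2 ∈ M₁.outDomain P x.1.1 x.2 :=
        (IndexedTree.substSet_nonempty_iff _).1 ⟨u, hu⟩
      obtain ⟨y, hy, ht⟩ := (key ζ hl).2 ⟨u, hu, htu⟩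
      rw [P.run_eq_eval hU ζ u hu] at hK
      exact ⟨_, ⟨r, hr, ζ, hζ, hK, y, hy, rfl⟩,
        (M₁.forall_mem_compRange P).2 ⟨hr', hl⟩, ht⟩

theorem transformation_compose (hP : M₂.LookaheadAutomaton P)
    (h : M₂.IsLinear ∨ M₁.IsDeterministic) :
    (compose M₁ M₂ P).transformation = M₁.transformation.comp M₂.transformation := by
  ext ⟨s, t⟩
  rw [mem_transformation_iff]
  change _ ↔ ∃ u, (s, u) ∈ M₁.transformation ∧ (u, t) ∈ M₂.transformation
  simp only [mem_transformation_iff]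
  constructor
  · rintro ⟨q, ⟨h₁, h₂, -⟩, ht⟩
    obtain ⟨u, hu, -, ht⟩ := (mem_out_compose hP h s q t).1 ht
    exact ⟨u, ⟨_, h₁, hu⟩, _, h₂, ht⟩
  · rintro ⟨u, ⟨q₁, h₁, hu⟩, q₂, h₂, ht⟩
    exact ⟨(q₁, q₂, Set.univ), ⟨h₁, h₂, rfl⟩,
      (mem_out_compose hP h s _ t).2 ⟨u, hu, Set.mem_univ _, ht⟩⟩

theorem IsDeterministic.compose (hP : M₂.LookaheadAutomaton P) (h₁ : M₁.IsDeterministic)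
    (h₂ : M₂.IsDeterministic) : (compose M₁ M₂ P).IsDeterministic := by
  refine ⟨?_, fun {k} q a => ?_⟩
  · obtain ⟨q₁, e₁⟩ := h₁.1
    obtain ⟨q₂, e₂⟩ := h₂.1
    refine ⟨(q₁, q₂, Set.univ), ?_⟩
    ext ⟨x, y, z⟩
    simp only [Transducer.compose, e₁, e₂, Set.mem_singleton_iff]
    constructor
    · rintro ⟨rfl, rfl, rfl⟩
      rfl
    · intro h
      obtain ⟨⟩ : (x, y, z) = (q₁, q₂, Set.univ) := h
      exact ⟨rfl, rfl, rfl⟩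
  · rintro _ ⟨r, hr, ζ, hζ, -, t, ht, rfl⟩ _ ⟨r', hr', ζ', hζ', -, t', ht', rfl⟩ hne
    -- If all ranges met, picking common elements `φ i` would give one input to which both rules
    -- apply; there the rule of `M₁`, the annotation and the output of `M₂` are all forced.
    by_contra! hi
    choose φ hφ hφ' using hi
    obtain ⟨hφr, hl⟩ := (M₁.forall_mem_compRange P).1 hφ
    obtain ⟨hφr', hl'⟩ := (M₁.forall_mem_compRange P).1 hφ'
    obtain rfl : r = r' := by
      by_contra hrr
      obtain ⟨i, hi⟩ := h₁.2 q.1 a r hr r' hr' hrr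
      exact hi.subset ⟨hφr i, hφr' i⟩
    obtain rfl : ζ = ζ' := by
      refine P.annotations_unique (G := fun y p => φ y.2 ∈ M₁.outDomain P y.1 p) ?_ hζ hζ' hl hl'
      rintro y _ _ ⟨u, hu, rfl⟩ ⟨v, hv, rfl⟩
      rw [h₁.out_subsingleton _ _ hu hv]
    obtain rfl : t = t' :=
      h₂.outIndexed_subsingleton hP (fun _ _ => Set.subsingleton_singleton) ζ q.2.1 ht ht'
    exact hne rfl

end Composition

end Transducer

end TreeTransducer

theorem theorem4p81 :
    TreeTransducer.TransformationClass.comp TreeTransducer.TR.{u} TreeTransducer.LTR.{u}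
        ≤ TreeTransducer.TR.{u} ∧
    TreeTransducer.TransformationClass.comp TreeTransducer.DTR.{u} TreeTransducer.TR.{u}
        ≤ TreeTransducer.TR.{u} ∧
    TreeTransducer.TransformationClass.comp TreeTransducer.DTR.{u} TreeTransducer.DTR.{u}
        ≤ TreeTransducer.DTR.{u} := by
  refine ⟨?_, ?_, ?_⟩
  · rintro A C _ ⟨B, _, _, ⟨M₁, rfl⟩, ⟨M₂, h₂, rfl⟩, rfl⟩
    obtain ⟨P, hP⟩ := M₂.exists_lookaheadAutomaton
    exact ⟨_, TreeTransducer.Transducer.transformation_compose hP (Or.inl h₂)⟩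
  · rintro A C _ ⟨B, _, _, ⟨M₁, h₁, rfl⟩, ⟨M₂, rfl⟩, rfl⟩
    obtain ⟨P, hP⟩ := M₂.exists_lookaheadAutomaton
    exact ⟨_, TreeTransducer.Transducer.transformation_compose hP (Or.inr h₁)⟩
  · rintro A C _ ⟨B, _, _, ⟨M₁, h₁, rfl⟩, ⟨M₂, h₂, rfl⟩, rfl⟩
    obtain ⟨P, hP⟩ := M₂.exists_lookaheadAutomaton
    exact ⟨_, h₁.compose hP h₂,
      TreeTransducer.Transducer.transformation_compose hP (Or.inr h₁)⟩
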